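/- Let $H, K$ be real or complex Hilbert spaces and let $T$ be a closed, densely defined linear operator from $D(T)\subset H$ to $K$ whose range $R(T)$ is closed. For a closed operator $S$ with domain $D(S)$, null space $N(S)$ and range $R(S)$, its Moore–Penrose inverse $S^\dagger$ is the linear operator with domain $R(S)\oplus R(S)^\perp$ given by $(S|_{D(S)\cap N(S)^\perp})^{-1}$ on $R(S)$ and by $0$ on $R(S)^\perp$. Products of operators carry their natural domains, and $w(T) = T(T^*T)^\dagger$ is the generalized Cauchy dual of $T$. Let $|T| = (T^*T)^{1/2}$ be the non-negative selfadjoint square root of $T^*T$ and let $T = U_T|T|$ be the polar decomposition, where $U_T$ is the partial isometry with initial space $R(|T|)$ and final space $R(T)$; let $U_{T^*}$ be the corresponding partial isometry for $T^*$. Then $|T|$ and the polar decomposition $T = U_T|T|$ exist, and $$w(T) = U_T|T|^\dagger .$$ Moreover, $T^\dagger$ and $|T|^\dagger$ are everywhere defined bounded operators with $$\|T^\dagger\| = \|\,|T|^\dagger\| .$$ Furthermore, $T^\dagger = |T|^\dagger U_{T^*}$ and $(T^*)^\dagger = U_T|T|^\dagger$. All equalities between operators include equality of domains. -/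

import Mathlib

noncomputable section

namespace LinearPMap

variable {𝕜 E F G : Type*} [RCLike 𝕜]
  [NormedAddCommGroup E] [InnerProductSpace 𝕜 E]
  [NormedAddCommGroup F] [InnerProductSpace 𝕜 F]
  [NormedAddCommGroup G] [InnerProductSpace 𝕜 G]

/-- The null space `N(T)`, as a subspace of the ambient space. -/
def nullSpace (T : E →ₗ.[𝕜] F) : Submodule 𝕜 E :=
  (LinearMap.ker T.toFun).map T.domain.subtype

/-- The range `R(T)`. -/
def rangeSpace (T : E →ₗ.[𝕜] F) : Submodule 𝕜 F :=
  LinearMap.range T.toFun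

theorem mem_nullSpace_iff (T : E →ₗ.[𝕜] F) (x : E) :
    x ∈ T.nullSpace ↔ ∃ h : x ∈ T.domain, T ⟨x, h⟩ = 0 := by
  constructor
  · rintro ⟨y, hy, rfl⟩
    exact ⟨y.2, hy⟩
  · rintro ⟨h, hx⟩
    exact ⟨⟨x, h⟩, hx, rfl⟩

/-- The natural domain `{x ∈ D(S) : S x ∈ D(R)}` of the product `R S`. -/
def prodDomain (R : F →ₗ.[𝕜] G) (S : E →ₗ.[𝕜] F) : Submodule 𝕜 E :=
  (R.domain.comap S.toFun).map S.domain.subtype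

theorem prodDomain_maps (R : F →ₗ.[𝕜] G) (S : E →ₗ.[𝕜] F)
    (x : (S.domRestrict (prodDomain R S)).domain) :
    S.domRestrict (prodDomain R S) x ∈ R.domain := by
  obtain ⟨x, hx, hxS⟩ := x
  obtain ⟨y, hy, rfl⟩ := hx
  have : S.domRestrict (prodDomain R S) ⟨y, ⟨⟨y, hy, rfl⟩, hxS⟩⟩ = S y :=
    domRestrict_apply rfl
  exact this ▸ hy

/-- The product `R S` of unbounded operators, `x ↦ R (S x)` on `{x ∈ D(S) : S x ∈ D(R)}`. -/
def prodOp (R : F →ₗ.[𝕜] G) (S : E →ₗ.[𝕜] F) : E →ₗ.[𝕜] G :=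
  R.comp (S.domRestrict (prodDomain R S)) (prodDomain_maps R S)

/-- The restriction of `T` to its carrier `C(T) = D(T) ∩ N(T)ᗮ`. -/
def carrierRestrict (T : E →ₗ.[𝕜] F) : E →ₗ.[𝕜] F :=
  T.domRestrict T.nullSpaceᗮ

theorem carrierRestrict_ker (T : E →ₗ.[𝕜] F) :
    LinearMap.ker T.carrierRestrict.toFun = ⊥ := by
  rw [LinearMap.ker_eq_bot']
  rintro ⟨x, hx, hxT⟩ h
  have h1 : T ⟨x, hxT⟩ = 0 := by
    rw [← h]
    exact (domRestrict_apply rfl).symm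
  have h2 : x ∈ T.nullSpace := (T.mem_nullSpace_iff x).2 ⟨hxT, h1⟩
  have h3 : x = 0 := by
    have := Submodule.inner_right_of_mem_orthogonal h2 hx
    exact inner_self_eq_zero.1 this
  exact Subtype.ext h3

theorem carrierRestrict_disjoint (T : E →ₗ.[𝕜] F) :
    Disjoint T.carrierRestrict.inverse.domain
      (⟨T.rangeSpaceᗮ, 0⟩ : F →ₗ.[𝕜] E).domain := by
  rw [inverse_domain]
  refine T.rangeSpace.orthogonal_disjoint.mono_left ?_
  rintro _ ⟨⟨x, hx, hxT⟩, rfl⟩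
  exact ⟨⟨x, hxT⟩, (domRestrict_apply rfl).symm⟩

/-- The Moore-Penrose inverse of a closed operator `T`: the linear operator that is
`(T|_{C(T)})⁻¹` on `R(T)` and `0` on `R(T)ᗮ`. -/
def moorePenrose (T : E →ₗ.[𝕜] F) : F →ₗ.[𝕜] E :=
  T.carrierRestrict.inverse.sup ⟨T.rangeSpaceᗮ, 0⟩
    (sup_h_of_disjoint _ _ T.carrierRestrict_disjoint)

/-- The generalized Cauchy dual `w(T) = T (T* T)^†`. -/
def cauchyDual [CompleteSpace E] (T : E →ₗ.[𝕜] F) : E →ₗ.[𝕜] F :=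
  T.prodOp (T.adjoint.prodOp T).moorePenrose

/-- `A` is a non-negative selfadjoint square root of `S`. -/
structure IsNonnegSqrt [CompleteSpace E] (S A : E →ₗ.[𝕜] E) : Prop where
  selfAdjoint : IsSelfAdjoint A
  nonneg : ∀ x : A.domain, 0 ≤ RCLike.re (inner 𝕜 (A x) (x : E))
  sq : A.prodOp A = S

open Classical in
/-- The (unique) non-negative selfadjoint square root of a non-negative selfadjoint operator;
the value is `0` when there is no such square root. -/
def nonnegSqrt [CompleteSpace E] (S : E →ₗ.[𝕜] E) : E →ₗ.[𝕜] E :=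
  if h : ∃ A, IsNonnegSqrt S A then h.choose else 0

/-- The modulus `|T| = (T* T)^{1/2}`. -/
def modulus [CompleteSpace E] (T : E →ₗ.[𝕜] F) : E →ₗ.[𝕜] E :=
  nonnegSqrt (T.adjoint.prodOp T)

/-- `U` is a partial isometry with initial space `M` and final space `N`. -/
structure IsPartialIsometryOn (U : E →L[𝕜] F) (M : Submodule 𝕜 E) (N : Submodule 𝕜 F) :
    Prop where
  isometry : ∀ x ∈ M, ‖U x‖ = ‖x‖
  vanish : ∀ x ∈ Mᗮ, U x = 0
  range_eq : LinearMap.range (U : E →ₗ[𝕜] F) = N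

/-- `T = U |T|` is the polar decomposition of `T`. (The closures are superfluous when `R(T)` is
closed, since then `R(|T|)` is closed as well.) -/
structure IsPolarIsometry [CompleteSpace E] (T : E →ₗ.[𝕜] F) (U : E →L[𝕜] F) : Prop where
  partialIsometry :
    IsPartialIsometryOn U T.modulus.rangeSpace.topologicalClosure T.rangeSpace.topologicalClosure
  factor : T = (U : E →ₗ[𝕜] F).compPMap T.modulus

open Classical in
/-- The (unique) partial isometry `U_T` of the polar decomposition `T = U_T |T|`;
the value is `0` when there is none. -/
def polarIsometry [CompleteSpace E] (T : E →ₗ.[𝕜] F) : E →L[𝕜] F :=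
  if h : ∃ U, IsPolarIsometry T U then h.choose else 0

/-- A bounded operator, as an operator with domain the whole space. -/
def ofBounded (B : E →L[𝕜] F) : E →ₗ.[𝕜] F :=
  (B : E →ₗ[𝕜] F).toPMap ⊤

end LinearPMap

end

/-!
# The modulus, the polar decomposition and the Cauchy dual of a closed operator with closed range

The Moore-Penrose inverse reduces the statements about the closed, densely defined operator `T` with
closed range to statements about bounded operators. By the closed graph theorem `T^†` is an
everywhere defined bounded operator `B` (`exists_moorePenrose_eq_ofBounded`), and conversely
`T = B^†` (`eq_moorePenrose_ofBounded`), where the graph of `B^†` consists of the pairs `(y, x)`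
with `x ∈ N(B)ᗮ` and `B* B x = B* y` (`mem_moorePenrose_ofBounded_graph`). Taking Moore-Penrose inverses
translates the operations on `T` into operations on `B`, with the correct domains:
`(B^†)* = (B*)^†`, `(B*)^† B^† = (B B*)^†` and `(B^†)^† = B`. In particular `T* T = (B B*)^†`.

The bounded positive operator `B B*` has a unique positive square root `C`. It is obtained here as a
norm limit of polynomials, a construction that works over `ℝ` as well as over `ℂ`. As the
non-negative selfadjoint square roots of `(B B*)^†` are the Moore-Penrose inverses of the positive
square roots of `B B*` (`IsNonnegSqrt.exists_isPositive`), the modulus is `|T| = C^†`, so that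
`|T|^† = C`. Since `‖C x‖ = ‖B* x‖`, there is a partial isometry `U` with `B* = U C`, and this is
the polar isometry of `T = B^†`. The claims now read

* `w(T) = B^† (B B*) = B* = U C = U |T|^†`,
* `‖T^†‖ = ‖B‖ = ‖B*‖ = ‖C‖ = ‖ |T|^† ‖`,
* `(T*)^† = B* = U C = U |T|^†`,
* `T^† = B = (U C)* = C U* = |T|^† U*`.

The last one also needs that `U*` is the polar isometry of `T*` (`IsPolarIsometry.adjoint_eq`),
which rests on the uniqueness of positive square roots, applied to `U C U*` and `B* B`.
-/

noncomputable section

namespace LinearPMap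

variable {𝕜 E F G : Type*} [RCLike 𝕜]
  [NormedAddCommGroup E] [InnerProductSpace 𝕜 E]
  [NormedAddCommGroup F] [InnerProductSpace 𝕜 F]
  [NormedAddCommGroup G] [InnerProductSpace 𝕜 G]

/-! ### Graphs of the basic constructions -/

theorem ext_graph {S T : E →ₗ.[𝕜] F} (h : ∀ x y, (x, y) ∈ S.graph ↔ (x, y) ∈ T.graph) : S = T :=
  eq_of_eq_graph (Submodule.ext fun ⟨x, y⟩ => h x y)

theorem mem_nullSpace_iff_graph (T : E →ₗ.[𝕜] F) (x : E) :
    x ∈ T.nullSpace ↔ (x, (0 : F)) ∈ T.graph := by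
  rw [mem_nullSpace_iff, mem_graph_iff]
  constructor
  · rintro ⟨h, hx⟩
    exact ⟨⟨x, h⟩, rfl, hx⟩
  · rintro ⟨⟨y, h⟩, rfl, hx⟩
    exact ⟨h, hx⟩

theorem mem_rangeSpace_iff_graph (T : E →ₗ.[𝕜] F) (y : F) :
    y ∈ T.rangeSpace ↔ ∃ x, (x, y) ∈ T.graph := by
  constructor
  · rintro ⟨x, rfl⟩
    exact ⟨x, T.mem_graph x⟩
  · rintro ⟨x, hx⟩
    obtain ⟨z, -, hz⟩ := T.mem_graph_iff.1 hx
    exact ⟨z, hz⟩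

theorem mem_domRestrict_graph (T : E →ₗ.[𝕜] F) (S : Submodule 𝕜 E) (x : E) (y : F) :
    (x, y) ∈ (T.domRestrict S).graph ↔ x ∈ S ∧ (x, y) ∈ T.graph := by
  simp only [mem_graph_iff]
  constructor
  · rintro ⟨⟨z, hzS, hz⟩, rfl, rfl⟩
    exact ⟨hzS, ⟨z, hz⟩, rfl, (domRestrict_apply rfl).symm⟩
  · rintro ⟨hS, ⟨z, hz⟩, rfl, rfl⟩
    exact ⟨⟨z, hS, hz⟩, rfl, domRestrict_apply rfl⟩

theorem mem_prodOp_graph (R : F →ₗ.[𝕜] G) (S : E →ₗ.[𝕜] F) (x : E) (z : G) :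
    (x, z) ∈ (R.prodOp S).graph ↔ ∃ y, (x, y) ∈ S.graph ∧ (y, z) ∈ R.graph := by
  constructor
  · intro h
    obtain ⟨w, hw, hz⟩ := (mem_graph_iff _).1 h
    change (S.domRestrict (prodDomain R S)).domain at w
    replace hw : (w : E) = x := hw
    replace hz : R.prodOp S w = z := hz
    have h1 := mem_graph _ w
    rw [mem_domRestrict_graph] at h1
    rw [hw] at h1
    refine ⟨S.domRestrict (prodDomain R S) w, h1.2, ?_⟩
    rw [← hz]
    exact R.mem_graph ⟨_, prodDomain_maps R S w⟩
  · rintro ⟨y, hS, hR⟩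
    obtain ⟨⟨x, hx⟩, rfl, rfl⟩ := (mem_graph_iff _).1 hS
    obtain ⟨⟨y, hy⟩, h, rfl⟩ := (mem_graph_iff _).1 hR
    obtain rfl : y = S ⟨x, hx⟩ := h
    rw [mem_graph_iff]
    have hd : x ∈ prodDomain R S := ⟨⟨x, hx⟩, hy, rfl⟩
    refine ⟨⟨x, hd, hx⟩, rfl, ?_⟩
    change R ⟨S.domRestrict (prodDomain R S) ⟨x, hd, hx⟩, _⟩ = _
    congr 1

theorem mem_sup_graph (f g : E →ₗ.[𝕜] F) (h : ∀ (x : f.domain) (y : g.domain),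
    (x : E) = y → f x = g y) (x : E) (y : F) :
    (x, y) ∈ (f.sup g h).graph ↔
      ∃ x₁ y₁ x₂ y₂, (x₁, y₁) ∈ f.graph ∧ (x₂, y₂) ∈ g.graph ∧ x = x₁ + x₂ ∧ y = y₁ + y₂ := by
  constructor
  · intro hxy
    obtain ⟨⟨x, hx⟩, rfl, rfl⟩ := (mem_graph_iff _).1 hxy
    obtain ⟨x₁, hx₁, x₂, hx₂, rfl⟩ := Submodule.mem_sup.1 hx
    exact ⟨x₁, _, x₂, _, f.mem_graph ⟨x₁, hx₁⟩, g.mem_graph ⟨x₂, hx₂⟩, rfl,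
      sup_apply h ⟨x₁, hx₁⟩ ⟨x₂, hx₂⟩ ⟨x₁ + x₂, hx⟩ rfl⟩
  · rintro ⟨x₁, y₁, x₂, y₂, h₁, h₂, rfl, rfl⟩
    exact add_mem (le_graph_of_le (LinearPMap.left_le_sup f g h) h₁)
      (le_graph_of_le (LinearPMap.right_le_sup f g h) h₂)

/-- In terms of graphs: `T^† y = x` iff `x ∈ N(T)ᗮ` and `T x` differs from `y` by an element of
`R(T)ᗮ`. -/
theorem mem_moorePenrose_graph (T : E →ₗ.[𝕜] F) (y : F) (x : E) :
    (y, x) ∈ T.moorePenrose.graph ↔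
      ∃ u, (x, u) ∈ T.graph ∧ x ∈ T.nullSpaceᗮ ∧ y - u ∈ T.rangeSpaceᗮ := by
  have hinv : ∀ u z, (u, z) ∈ T.carrierRestrict.inverse.graph ↔
      z ∈ T.nullSpaceᗮ ∧ (z, u) ∈ T.graph := by
    intro u z
    rw [inverse_graph T.carrierRestrict_ker, ← mem_domRestrict_graph]
    simp only [Submodule.mem_map, LinearEquiv.coe_coe, LinearEquiv.prodComm_apply, Prod.exists,
      Prod.swap_prod_mk, Prod.mk.injEq]
    constructor
    · rintro ⟨a, b, h, rfl, rfl⟩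
      exact h
    · intro h
      exact ⟨z, u, h, rfl, rfl⟩
  rw [moorePenrose, mem_sup_graph]
  constructor
  · rintro ⟨u, z, n, w, h₁, h₂, rfl, rfl⟩
    rw [hinv] at h₁
    obtain ⟨n, rfl, hw⟩ := (mem_graph_iff _).1 h₂
    replace hw : w = 0 := hw.symm
    subst hw
    refine ⟨u, by simpa using h₁.2, by simpa using h₁.1, by simp⟩
  · rintro ⟨u, h, hx, hu⟩
    refine ⟨u, x, y - u, 0, (hinv _ _).2 ⟨hx, h⟩, ?_, by simp, by simp⟩
    exact (mem_graph_iff _).2 ⟨⟨y - u, hu⟩, rfl, rfl⟩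

@[simp]
theorem mem_ofBounded_graph (B : E →L[𝕜] F) (x : E) (y : F) :
    (x, y) ∈ (ofBounded B).graph ↔ y = B x := by
  rw [mem_graph_iff]
  constructor
  · rintro ⟨z, rfl, rfl⟩
    rfl
  · rintro rfl
    exact ⟨⟨x, trivial⟩, rfl, rfl⟩

theorem mem_compPMap_graph (g : F →ₗ[𝕜] G) (f : E →ₗ.[𝕜] F) (x : E) (z : G) :
    (x, z) ∈ (g.compPMap f).graph ↔ ∃ y, (x, y) ∈ f.graph ∧ z = g y := by
  constructor
  · intro h
    obtain ⟨x, rfl, rfl⟩ := (mem_graph_iff _).1 h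
    exact ⟨f x, f.mem_graph x, rfl⟩
  · rintro ⟨y, h, rfl⟩
    obtain ⟨x, rfl, rfl⟩ := (mem_graph_iff _).1 h
    exact (mem_graph_iff _).2 ⟨x, rfl, rfl⟩

theorem mem_adjoint_graph [CompleteSpace E] {T : E →ₗ.[𝕜] F} (hT : Dense (T.domain : Set E))
    (y : F) (x : E) :
    (y, x) ∈ T.adjoint.graph ↔ ∀ a b, (a, b) ∈ T.graph → inner 𝕜 b y = inner 𝕜 a x := by
  rw [adjoint_graph_eq_graph_adjoint hT, Submodule.mem_adjoint_iff]
  simp only [sub_eq_zero]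

theorem prodOp_ofBounded (A : F →L[𝕜] G) (B : E →L[𝕜] F) :
    (ofBounded A).prodOp (ofBounded B) = ofBounded (A ∘L B) := by
  refine ext_graph fun x y => ?_
  simp only [mem_prodOp_graph, mem_ofBounded_graph, exists_eq_left]
  rfl

theorem ofBounded_injective : Function.Injective (ofBounded : (E →L[𝕜] F) → E →ₗ.[𝕜] F) := by
  intro A B h
  ext x
  exact (mem_ofBounded_graph B x _).1 (h ▸ (mem_ofBounded_graph A x _).2 rfl)

/-! ### Moore-Penrose inverses of bounded operators -/

theorem nullSpace_ofBounded (B : E →L[𝕜] F) : (ofBounded B).nullSpace = B.ker := by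
  ext x
  rw [mem_nullSpace_iff_graph, mem_ofBounded_graph]
  exact eq_comm

theorem rangeSpace_ofBounded (B : E →L[𝕜] F) : (ofBounded B).rangeSpace = B.range := by
  ext x
  simp only [mem_rangeSpace_iff_graph, mem_ofBounded_graph]
  exact exists_congr fun _ => eq_comm


theorem eq_of_mem_ker_orthogonal {B : E →L[𝕜] F} {x y : E} (hx : x ∈ B.kerᗮ) (hy : y ∈ B.kerᗮ)
    (h : B x = B y) : x = y := by
  have h1 : x - y ∈ B.ker := by simp [h]
  exact sub_eq_zero.1 (B.ker.orthogonal_disjoint.le_bot ⟨h1, sub_mem hx hy⟩)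

theorem exists_mem_ker_orthogonal [CompleteSpace E] (B : E →L[𝕜] F) (x : E) :
    ∃ y ∈ B.kerᗮ, B y = B x := by
  obtain ⟨k, hk, y, hy, rfl⟩ := B.ker.exists_add_mem_mem_orthogonal x
  exact ⟨y, hy, by simpa using hk⟩

variable [CompleteSpace E] [CompleteSpace F]

/-- The graph of `B^†` consists of the minimal least squares solutions, described by the normal
equation `B* B x = B* y`. -/
theorem mem_moorePenrose_ofBounded_graph (B : E →L[𝕜] F) (y : F) (x : E) :
    (y, x) ∈ (ofBounded B).moorePenrose.graph ↔
      x ∈ B.kerᗮ ∧ B.adjoint (B x) = B.adjoint y := by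
  rw [mem_moorePenrose_graph, nullSpace_ofBounded, rangeSpace_ofBounded, B.orthogonal_range]
  simp only [mem_ofBounded_graph, exists_eq_left]
  refine and_congr_right fun _ => ?_
  rw [LinearMap.mem_ker, ContinuousLinearMap.coe_coe, _root_.map_sub, sub_eq_zero, eq_comm]

theorem adjoint_apply_mem_ker_orthogonal (B : E →L[𝕜] F) (y : F) : B.adjoint y ∈ B.kerᗮ := by
  rw [B.orthogonal_ker]
  exact Submodule.le_topologicalClosure _ ⟨y, rfl⟩

theorem nullSpace_moorePenrose_ofBounded (B : E →L[𝕜] F) :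
    (ofBounded B).moorePenrose.nullSpace = B.adjoint.ker := by
  ext x
  rw [mem_nullSpace_iff_graph, mem_moorePenrose_ofBounded_graph]
  simp [eq_comm (a := (0 : E))]

theorem rangeSpace_moorePenrose_ofBounded (B : E →L[𝕜] F) :
    (ofBounded B).moorePenrose.rangeSpace = B.kerᗮ := by
  ext x
  simp only [mem_rangeSpace_iff_graph, mem_moorePenrose_ofBounded_graph]
  exact ⟨fun ⟨_, h⟩ => h.1, fun h => ⟨B x, h, rfl⟩⟩

theorem dense_domain_moorePenrose_ofBounded (B : E →L[𝕜] F) :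
    Dense ((ofBounded B).moorePenrose.domain : Set F) := by
  rw [Submodule.dense_iff_topologicalClosure_eq_top, Submodule.topologicalClosure_eq_top_iff,
    eq_bot_iff]
  intro v hv
  have hle : B.range ≤ (ofBounded B).moorePenrose.domain := by
    rintro _ ⟨x, rfl⟩
    obtain ⟨y, hy, hyx⟩ := exists_mem_ker_orthogonal B x
    exact mem_domain_of_mem_graph ((mem_moorePenrose_ofBounded_graph B _ y).2 ⟨hy, by simp [hyx]⟩)
  have hle' : B.adjoint.ker ≤ (ofBounded B).moorePenrose.domain := fun x hx =>
    mem_domain_of_mem_graph ((mem_moorePenrose_ofBounded_graph B x 0).2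
      ⟨zero_mem _, by simpa using hx.symm⟩)
  have h1 : v ∈ B.adjoint.ker := B.orthogonal_range ▸ Submodule.orthogonal_le hle hv
  exact (Submodule.mem_bot 𝕜).2 (inner_self_eq_zero.1
    (Submodule.inner_right_of_mem_orthogonal (hle' h1) hv))

/-- `(B^†)^† = B`. -/
theorem moorePenrose_moorePenrose_ofBounded (B : E →L[𝕜] F) :
    (ofBounded B).moorePenrose.moorePenrose = ofBounded B := by
  refine ext_graph fun x y => ?_
  rw [mem_moorePenrose_graph, nullSpace_moorePenrose_ofBounded, rangeSpace_moorePenrose_ofBounded,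
    mem_ofBounded_graph, Submodule.orthogonal_orthogonal]
  simp only [mem_moorePenrose_ofBounded_graph]
  constructor
  · rintro ⟨u, ⟨-, h⟩, hy, hk⟩
    have h1 : B x = B u := by simpa [sub_eq_zero] using hk
    refine eq_of_mem_ker_orthogonal hy ?_ (h1 ▸ h.symm)
    simpa using adjoint_apply_mem_ker_orthogonal B.adjoint x
  · rintro rfl
    obtain ⟨u, hu, hux⟩ := exists_mem_ker_orthogonal B x
    exact ⟨u, ⟨hu, by rw [hux]⟩, by simpa using adjoint_apply_mem_ker_orthogonal B.adjoint x,
      by simp [hux]⟩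

theorem moorePenrose_ofBounded_injective :
    Function.Injective fun B : E →L[𝕜] F => (ofBounded B).moorePenrose := fun A B h => by
  refine ofBounded_injective ?_
  rw [← moorePenrose_moorePenrose_ofBounded A, ← moorePenrose_moorePenrose_ofBounded B]
  exact congrArg _ h

/-- `(B^†)* = (B*)^†`. -/
theorem adjoint_moorePenrose_ofBounded (B : E →L[𝕜] F) :
    (ofBounded B).moorePenrose.adjoint = (ofBounded B.adjoint).moorePenrose := by
  refine ext_graph fun y x => ?_
  rw [mem_adjoint_graph (dense_domain_moorePenrose_ofBounded B), mem_moorePenrose_ofBounded_graph,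
    ContinuousLinearMap.adjoint_adjoint]
  simp only [mem_moorePenrose_ofBounded_graph]
  constructor
  · intro h
    refine ⟨fun n hn => ?_, ?_⟩
    · simpa using (h n 0 ⟨zero_mem _, by simpa using hn.symm⟩).symm
    · -- `y - B* x` is orthogonal to `N(B)ᗮ`, hence lies in `N(B)`.
      have h1 : y - B.adjoint x ∈ B.kerᗮᗮ := fun b hb => by
        rw [inner_sub_right, h (B b) b ⟨hb, rfl⟩, B.adjoint_inner_right, sub_self]
      rw [Submodule.orthogonal_orthogonal] at h1
      have h2 : B (y - B.adjoint x) = 0 := h1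
      rw [_root_.map_sub, sub_eq_zero] at h2
      exact h2.symm
  · rintro ⟨hx, h⟩ a b ⟨hb, hab⟩
    have h1 : inner 𝕜 b (y - B.adjoint x) = 0 :=
      Submodule.inner_left_of_mem_orthogonal (by simp [h]) hb
    have h2 : inner 𝕜 (B b - a) x = 0 :=
      Submodule.inner_right_of_mem_orthogonal (by simp [hab]) hx
    rw [inner_sub_right, sub_eq_zero] at h1
    rw [inner_sub_left, sub_eq_zero] at h2
    rw [h1, B.adjoint_inner_right, h2]

/-- `(B*)^† B^† = (B B*)^†`, with equality of domains. -/
theorem prodOp_moorePenrose_ofBounded (B : E →L[𝕜] F) :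
    (ofBounded B.adjoint).moorePenrose.prodOp (ofBounded B).moorePenrose =
      (ofBounded (B ∘L B.adjoint)).moorePenrose := by
  refine ext_graph fun x z => ?_
  simp only [mem_prodOp_graph, mem_moorePenrose_ofBounded_graph,
    ContinuousLinearMap.adjoint_adjoint, B.ker_self_comp_adjoint,
    ContinuousLinearMap.adjoint_comp, ContinuousLinearMap.comp_apply]
  constructor
  · rintro ⟨y, ⟨hy, hyx⟩, hz, h⟩
    exact ⟨hz, by rw [h, hyx]⟩
  · rintro ⟨hz, h⟩
    refine ⟨B.adjoint z, ⟨adjoint_apply_mem_ker_orthogonal B z, ?_⟩, hz, rfl⟩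
    refine eq_of_mem_ker_orthogonal (adjoint_apply_mem_ker_orthogonal B _)
      (adjoint_apply_mem_ker_orthogonal B _) h

/-! ### Closed operators with closed range -/

omit [CompleteSpace E] [CompleteSpace F] in
theorem isClosed_nullSpace {T : E →ₗ.[𝕜] F} (hT : T.IsClosed) :
    _root_.IsClosed (T.nullSpace : Set E) := by
  have h : (T.nullSpace : Set E) = (fun x : E => (x, (0 : F))) ⁻¹' (T.graph : Set (E × F)) :=
    Set.ext fun x => T.mem_nullSpace_iff_graph x
  rw [h]
  exact _root_.IsClosed.preimage (by fun_prop) hT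

omit [CompleteSpace F] in
theorem exists_mem_graph_nullSpace_orthogonal {T : E →ₗ.[𝕜] F} (hT : T.IsClosed) {x : E} {u : F}
    (h : (x, u) ∈ T.graph) :
    ∃ z ∈ T.nullSpaceᗮ, (z, u) ∈ T.graph ∧ x - z ∈ T.nullSpace := by
  have : CompleteSpace T.nullSpace := (isClosed_nullSpace hT).completeSpace_coe
  obtain ⟨n, hn, z, hz, rfl⟩ := T.nullSpace.exists_add_mem_mem_orthogonal x
  refine ⟨z, hz, ?_, by simpa using hn⟩
  simpa using sub_mem h ((T.mem_nullSpace_iff_graph n).1 hn)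

/-- A closed operator with closed range has a bounded Moore-Penrose inverse, by the closed graph
theorem. -/
theorem exists_moorePenrose_eq_ofBounded {T : E →ₗ.[𝕜] F} (hT : T.IsClosed)
    (hR : _root_.IsClosed (T.rangeSpace : Set F)) :
    ∃ B : F →L[𝕜] E, T.moorePenrose = ofBounded B := by
  have : CompleteSpace T.rangeSpace := hR.completeSpace_coe
  have hdom : T.moorePenrose.domain = ⊤ := by
    refine eq_top_iff.2 fun y _ => ?_
    obtain ⟨u, hu, v, hv, rfl⟩ := T.rangeSpace.exists_add_mem_mem_orthogonal y
    obtain ⟨x, hx⟩ := (T.mem_rangeSpace_iff_graph u).1 hu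
    obtain ⟨z, hz, hzu, -⟩ := exists_mem_graph_nullSpace_orthogonal hT hx
    exact mem_domain_of_mem_graph ((T.mem_moorePenrose_graph _ z).2 ⟨u, hzu, hz, by simpa using hv⟩)
  let f : F →ₗ[𝕜] E := T.moorePenrose.toFun ∘ₗ (LinearEquiv.ofTop _ hdom).symm.toLinearMap
  have hf : ∀ y x, x = f y ↔ (y, x) ∈ T.moorePenrose.graph := by
    intro y x
    rw [mem_graph_iff]
    constructor
    · rintro rfl
      exact ⟨(LinearEquiv.ofTop _ hdom).symm y, rfl, rfl⟩
    · rintro ⟨⟨w, hw⟩, rfl, rfl⟩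
      rfl
  have hgraph : (f.graph : Set (F × E)) =
      {p | (p.2, T.rangeSpace.starProjection p.1) ∈ T.graph ∧ p.2 ∈ T.nullSpaceᗮ} := by
    ext ⟨y, x⟩
    simp only [SetLike.mem_coe, LinearMap.mem_graph_iff, hf, mem_moorePenrose_graph,
      Set.mem_ofPred_eq]
    constructor
    · rintro ⟨u, h, hx, hu⟩
      have : T.rangeSpace.starProjection y = u :=
        Submodule.eq_starProjection_of_mem_orthogonal ((T.mem_rangeSpace_iff_graph u).2 ⟨x, h⟩) hu
      exact ⟨this ▸ h, hx⟩
    · rintro ⟨h, hx⟩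
      exact ⟨_, h, hx, Submodule.sub_starProjection_mem_orthogonal y⟩
  have hclosed : _root_.IsClosed (f.graph : Set (F × E)) := by
    rw [hgraph]
    exact (_root_.IsClosed.preimage (f := fun p : F × E => (p.2, T.rangeSpace.starProjection p.1))
      (by fun_prop) hT).inter
        (_root_.IsClosed.preimage (continuous_snd : Continuous (Prod.snd : F × E → E))
          (Submodule.isClosed_orthogonal _))
  refine ⟨ContinuousLinearMap.ofIsClosedGraph hclosed, ext_graph fun y x => ?_⟩
  rw [mem_ofBounded_graph, ← hf]
  rfl

/-- If the Moore-Penrose inverse of a closed, densely defined operator `T` with closed range is the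
bounded operator `B`, then conversely `T` is the Moore-Penrose inverse of `B`. -/
theorem eq_moorePenrose_ofBounded {T : E →ₗ.[𝕜] F} (hd : Dense (T.domain : Set E))
    (hT : T.IsClosed) (hR : _root_.IsClosed (T.rangeSpace : Set F)) {B : F →L[𝕜] E}
    (hB : T.moorePenrose = ofBounded B) : T = (ofBounded B).moorePenrose := by
  have : CompleteSpace T.rangeSpace := hR.completeSpace_coe
  have : CompleteSpace T.nullSpace := (isClosed_nullSpace hT).completeSpace_coe
  have hB' : ∀ y x, x = B y ↔ ∃ u, (x, u) ∈ T.graph ∧ x ∈ T.nullSpaceᗮ ∧ y - u ∈ T.rangeSpaceᗮ := by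
    intro y x
    rw [← mem_ofBounded_graph, ← hB, mem_moorePenrose_graph]
  have hker : B.ker = T.rangeSpaceᗮ := by
    ext k
    rw [LinearMap.mem_ker, ContinuousLinearMap.coe_coe, eq_comm, hB']
    constructor
    · rintro ⟨u, hu, -, hk⟩
      obtain rfl : u = 0 := T.graph_fst_eq_zero_snd hu rfl
      simpa using hk
    · intro hk
      exact ⟨0, zero_mem _, zero_mem _, by simpa using hk⟩
  have hkero : B.kerᗮ = T.rangeSpace := by
    rw [hker, Submodule.orthogonal_orthogonal]
  have hran : B.adjoint.ker = T.nullSpace := by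
    rw [← B.orthogonal_range]
    refine le_antisymm (fun v hv => ?_) ?_
    · -- `R(B)` contains the projection of `D(T)` to `N(T)ᗮ`, which is dense there.
      have h0 : T.nullSpaceᗮ.starProjection v = 0 := by
        refine hd.eq_zero_of_inner_right 𝕜 fun x hx => ?_
        obtain ⟨z, hz, hzu, hxz⟩ := exists_mem_graph_nullSpace_orthogonal hT (T.mem_graph ⟨x, hx⟩)
        have hPx : T.nullSpaceᗮ.starProjection x = z :=
          Submodule.eq_starProjection_of_mem_orthogonal hz
            (Submodule.le_orthogonal_orthogonal _ hxz)
        rw [← Submodule.inner_starProjection_left_eq_right, hPx]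
        exact hv _ ⟨T ⟨x, hx⟩, ((hB' _ z).2 ⟨_, hzu, hz, by simp⟩).symm⟩
      rwa [Submodule.starProjection_apply_eq_zero_iff, Submodule.orthogonal_orthogonal] at h0
    · refine (Submodule.le_orthogonal_orthogonal _).trans (Submodule.orthogonal_le ?_)
      rintro _ ⟨y, rfl⟩
      obtain ⟨u, -, h, -⟩ := (hB' y (B y)).1 rfl
      exact h
  refine ext_graph fun x u => ?_
  have hnormal : B.adjoint (B u) = B.adjoint x ↔ x - B u ∈ B.adjoint.ker := by
    rw [LinearMap.mem_ker, ContinuousLinearMap.coe_coe, _root_.map_sub, sub_eq_zero, eq_comm]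
  rw [mem_moorePenrose_ofBounded_graph, hkero, hnormal, hran]
  constructor
  · intro h
    refine ⟨(T.mem_rangeSpace_iff_graph u).2 ⟨x, h⟩, ?_⟩
    obtain ⟨z, hz, hzu, hxz⟩ := exists_mem_graph_nullSpace_orthogonal hT h
    rwa [← (hB' u z).2 ⟨u, hzu, hz, by simp⟩]
  · rintro ⟨hu, hx⟩
    obtain ⟨w, hw⟩ := (T.mem_rangeSpace_iff_graph u).1 hu
    obtain ⟨z, hz, hzu, -⟩ := exists_mem_graph_nullSpace_orthogonal hT hw
    rw [← (hB' u z).2 ⟨u, hzu, hz, by simp⟩, mem_nullSpace_iff_graph] at hx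
    simpa using add_mem hx hzu

end LinearPMap

/-! ### Square roots of bounded positive operators -/

/-- The recursion `y ↦ (1 + y²) / 2` dominates the iteration `Y ↦ (X + Y²) / 2` for `‖X‖ ≤ 1`. -/
def sqrtMajorant : ℕ → ℝ
  | 0 => 0
  | n + 1 => (1 + sqrtMajorant n ^ 2) / 2

theorem sqrtMajorant_nonneg : ∀ n, 0 ≤ sqrtMajorant n
  | 0 => le_rfl
  | n + 1 => by rw [sqrtMajorant]; positivity

theorem sqrtMajorant_le_one : ∀ n, sqrtMajorant n ≤ 1
  | 0 => zero_le_one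
  | n + 1 => by
    have := sqrtMajorant_nonneg n
    have := sqrtMajorant_le_one n
    rw [sqrtMajorant]
    nlinarith

theorem sqrtMajorant_mono : Monotone sqrtMajorant := by
  refine monotone_nat_of_le_succ fun n => ?_
  rw [sqrtMajorant]
  nlinarith [sq_nonneg (sqrtMajorant n - 1)]

section

variable (𝕜 : Type*) {A : Type*} [RCLike 𝕜] [NormedRing A] [NormedAlgebra 𝕜 A]

/-- The iteration `Y ↦ (X + Y²) / 2`, started at `0`, whose limit is `1 - √(1 - X)`. -/
def sqrtIter (X : A) : ℕ → A
  | 0 => 0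
  | n + 1 => (2⁻¹ : 𝕜) • (X + sqrtIter X n * sqrtIter X n)

variable {X : A}

theorem norm_sqrtIter_le (hX : ‖X‖ ≤ 1) : ∀ n, ‖sqrtIter 𝕜 X n‖ ≤ sqrtMajorant n
  | 0 => by simp [sqrtIter, sqrtMajorant]
  | n + 1 => by
    have ih := norm_sqrtIter_le hX n
    rw [sqrtIter, sqrtMajorant, norm_smul, norm_inv, RCLike.norm_two]
    have h1 := norm_add_le X (sqrtIter 𝕜 X n * sqrtIter 𝕜 X n)
    have h2 := norm_mul_le (sqrtIter 𝕜 X n) (sqrtIter 𝕜 X n)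
    have h3 := mul_le_mul ih ih (norm_nonneg _) (sqrtMajorant_nonneg n)
    linarith

theorem norm_sqrtIter_succ_sub_le (hX : ‖X‖ ≤ 1) : ∀ n,
    ‖sqrtIter 𝕜 X (n + 1) - sqrtIter 𝕜 X n‖ ≤ sqrtMajorant (n + 1) - sqrtMajorant n
  | 0 => by simpa [sqrtIter, sqrtMajorant] using norm_sqrtIter_le 𝕜 hX 1
  | n + 1 => by
    have ih := norm_sqrtIter_succ_sub_le hX n
    have ha := norm_sqrtIter_le 𝕜 hX n
    have hb := norm_sqrtIter_le 𝕜 hX (n + 1)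
    have h : sqrtIter 𝕜 X (n + 1 + 1) - sqrtIter 𝕜 X (n + 1) = (2⁻¹ : 𝕜) •
        (sqrtIter 𝕜 X (n + 1) * (sqrtIter 𝕜 X (n + 1) - sqrtIter 𝕜 X n) +
          (sqrtIter 𝕜 X (n + 1) - sqrtIter 𝕜 X n) * sqrtIter 𝕜 X n) := by
      have h1 : sqrtIter 𝕜 X (n + 1) = (2⁻¹ : 𝕜) • (X + sqrtIter 𝕜 X n * sqrtIter 𝕜 X n) := rfl
      have h2 : sqrtIter 𝕜 X (n + 1 + 1) =
        (2⁻¹ : 𝕜) • (X + sqrtIter 𝕜 X (n + 1) * sqrtIter 𝕜 X (n + 1)) := rfl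
      rw [h2]
      conv_lhs => enter [2]; rw [h1]
      rw [← smul_sub]
      congr 1
      noncomm_ring
    have h' : sqrtMajorant (n + 1 + 1) - sqrtMajorant (n + 1) = 2⁻¹ *
        (sqrtMajorant (n + 1) * (sqrtMajorant (n + 1) - sqrtMajorant n) +
          (sqrtMajorant (n + 1) - sqrtMajorant n) * sqrtMajorant n) := by
      have h2 : sqrtMajorant (n + 1 + 1) = (1 + sqrtMajorant (n + 1) ^ 2) / 2 := rfl
      rw [h2]
      have : sqrtMajorant (n + 1) = (1 + sqrtMajorant n ^ 2) / 2 := rfl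
      nlinarith
    rw [h, h', norm_smul, norm_inv, RCLike.norm_two]
    have h0 := sub_nonneg.2 (sqrtMajorant_mono n.le_succ)
    refine mul_le_mul_of_nonneg_left ((norm_add_le _ _).trans (add_le_add ?_ ?_)) (by norm_num)
    · exact (norm_mul_le _ _).trans (mul_le_mul hb ih (norm_nonneg _) (sqrtMajorant_nonneg _))
    · exact (norm_mul_le _ _).trans (mul_le_mul ih ha (norm_nonneg _) h0)

/-- In a Banach algebra `1 - X` has a square root `1 - Y` if `‖X‖ ≤ 1`, and `Y` may be taken as a
limit of polynomials in `X` without constant term. -/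
theorem exists_tendsto_sqrtIter [CompleteSpace A] (hX : ‖X‖ ≤ 1) :
    ∃ Y : A, Filter.Tendsto (sqrtIter 𝕜 X) Filter.atTop (nhds Y) ∧ ‖Y‖ ≤ 1 ∧
      (1 - Y) * (1 - Y) = 1 - X := by
  have hsum : Summable fun n => sqrtMajorant (n + 1) - sqrtMajorant n := by
    refine summable_of_sum_range_le (c := 1)
      (fun n => sub_nonneg.2 (sqrtMajorant_mono n.le_succ)) fun n => ?_
    rw [Finset.sum_range_sub]
    simpa [sqrtMajorant] using sqrtMajorant_le_one n
  obtain ⟨Y, hY⟩ := cauchySeq_tendsto_of_complete (cauchySeq_of_dist_le_of_summable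
    (f := sqrtIter 𝕜 X) _
    (fun n => by rw [dist_comm, dist_eq_norm]; exact norm_sqrtIter_succ_sub_le 𝕜 hX n) hsum)
  refine ⟨Y, hY, le_of_tendsto hY.norm (Filter.Eventually.of_forall fun n =>
    (norm_sqrtIter_le 𝕜 hX n).trans (sqrtMajorant_le_one n)), ?_⟩
  have h1 : Y = (2⁻¹ : 𝕜) • (X + Y * Y) :=
    tendsto_nhds_unique ((Filter.tendsto_add_atTop_iff_nat 1).2 hY)
      ((tendsto_const_nhds.add (hY.mul hY)).const_smul (2⁻¹ : 𝕜))
  have h2 : Y + Y = X + Y * Y := by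
    rw [← two_smul 𝕜 Y]
    conv_lhs => rw [h1]
    rw [smul_smul, mul_inv_cancel₀ two_ne_zero, one_smul]
  have h3 : (1 - Y) * (1 - Y) = 1 - (Y + Y) + Y * Y := by noncomm_ring
  rw [h3, h2]
  abel

theorem commute_sqrtIter {Z : A} (h : Commute Z X) : ∀ n, Commute Z (sqrtIter 𝕜 X n)
  | 0 => Commute.zero_right Z
  | n + 1 => (h.add_right ((commute_sqrtIter h n).mul_right (commute_sqrtIter h n))).smul_right _

theorem isSelfAdjoint_sqrtIter [StarRing A] [StarModule 𝕜 A] (h : IsSelfAdjoint X) :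
    ∀ n, IsSelfAdjoint (sqrtIter 𝕜 X n)
  | 0 => IsSelfAdjoint.zero A
  | n + 1 => by
    have ih := isSelfAdjoint_sqrtIter h n
    refine IsSelfAdjoint.smul (by simp [isSelfAdjoint_iff]) (h.add ?_)
    simpa [ih.star_eq] using IsSelfAdjoint.star_mul_self (sqrtIter 𝕜 X n)

end

namespace ContinuousLinearMap

variable {𝕜 E F : Type*} [RCLike 𝕜]
  [NormedAddCommGroup E] [InnerProductSpace 𝕜 E] [CompleteSpace E]
  [NormedAddCommGroup F] [InnerProductSpace 𝕜 F] [CompleteSpace F]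

theorem norm_one_sub_smul_self_comp_adjoint_le (B : E →L[𝕜] F) {c : ℝ} (hc : 0 ≤ c)
    (hcB : c * ‖B‖ ^ 2 ≤ 1) : ‖1 - (c : 𝕜) • (B ∘L B.adjoint)‖ ≤ 1 := by
  refine opNorm_le_bound _ zero_le_one fun x => ?_
  rw [one_mul]
  refine le_of_sq_le_sq ?_ (norm_nonneg _)
  have h1 : RCLike.re (inner 𝕜 x ((c : 𝕜) • B (B.adjoint x))) = c * ‖B.adjoint x‖ ^ 2 := by
    rw [inner_smul_right, ← B.adjoint_inner_left, inner_self_eq_norm_sq_to_K, RCLike.re_ofReal_mul]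
    norm_cast
  have h2 : ‖(c : 𝕜) • B (B.adjoint x)‖ ^ 2 ≤ c * ‖B.adjoint x‖ ^ 2 := by
    rw [norm_smul, RCLike.norm_ofReal, abs_of_nonneg hc, mul_pow]
    have h3 : ‖B (B.adjoint x)‖ ^ 2 ≤ ‖B‖ ^ 2 * ‖B.adjoint x‖ ^ 2 := by
      rw [← mul_pow]
      exact pow_le_pow_left₀ (norm_nonneg _) (B.le_opNorm _) 2
    calc c ^ 2 * ‖B (B.adjoint x)‖ ^ 2 ≤ c ^ 2 * (‖B‖ ^ 2 * ‖B.adjoint x‖ ^ 2) := by gcongr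
      _ = c * ‖B‖ ^ 2 * (c * ‖B.adjoint x‖ ^ 2) := by ring
      _ ≤ 1 * (c * ‖B.adjoint x‖ ^ 2) := by gcongr
      _ = c * ‖B.adjoint x‖ ^ 2 := one_mul _
  have h4 : (1 - (c : 𝕜) • (B ∘L B.adjoint)) x = x - (c : 𝕜) • B (B.adjoint x) := rfl
  have h5 : 0 ≤ c * ‖B.adjoint x‖ ^ 2 := by positivity
  rw [h4, norm_sub_sq (𝕜 := 𝕜), h1]
  linarith

/-- The positive operator `B B*` has a positive square root, which commutes with every bounded
operator commuting with `B B*`. -/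
theorem exists_isPositive_mul_self_eq (B : E →L[𝕜] F) :
    ∃ C : F →L[𝕜] F, C.IsPositive ∧ C * C = B ∘L B.adjoint ∧
      ∀ Z : F →L[𝕜] F, Commute Z (B ∘L B.adjoint) → Commute Z C := by
  -- Rescale, so that the norm of `1 - c B B*` is at most `1`.
  set c : ℝ := (‖B‖ ^ 2 + 1)⁻¹ with hc
  have hc0 : 0 < c := by positivity
  have hcB : c * ‖B‖ ^ 2 ≤ 1 := by
    rw [hc, inv_mul_le_iff₀ (by positivity)]
    linarith
  set X : F →L[𝕜] F := 1 - (c : 𝕜) • (B ∘L B.adjoint) with hXdef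
  obtain ⟨Y, hY, hY1, hYX⟩ :=
    exists_tendsto_sqrtIter 𝕜 (norm_one_sub_smul_self_comp_adjoint_le B hc0.le hcB)
  rw [← hXdef] at hY hYX
  have hBsa : IsSelfAdjoint (B ∘L B.adjoint) := (isPositive_self_comp_adjoint B).isSelfAdjoint
  have hXsa : IsSelfAdjoint X :=
    (IsSelfAdjoint.one _).sub (IsSelfAdjoint.smul (by simp [isSelfAdjoint_iff]) hBsa)
  have hYsa : IsSelfAdjoint Y := by
    have h : Filter.Tendsto (fun n => star (sqrtIter 𝕜 X n)) Filter.atTop (nhds (star Y)) :=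
      hY.star
    have h' : ∀ n, star (sqrtIter 𝕜 X n) = sqrtIter 𝕜 X n :=
      isSelfAdjoint_sqrtIter (A := F →L[𝕜] F) 𝕜 hXsa
    simp only [h'] at h
    exact tendsto_nhds_unique h hY
  have hpos : (1 - Y).IsPositive := by
    refine isPositive_def'.2 ⟨(IsSelfAdjoint.one _).sub hYsa, fun x => ?_⟩
    have h1 : RCLike.re (inner 𝕜 (Y x) x) ≤ ‖x‖ * ‖x‖ :=
      (re_inner_le_norm _ _).trans (mul_le_mul_of_nonneg_right
        ((Y.le_opNorm x).trans (mul_le_of_le_one_left (norm_nonneg _) hY1)) (norm_nonneg _))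
    have h2 : (1 - Y).reApplyInnerSelf x = ‖x‖ * ‖x‖ - RCLike.re (inner 𝕜 (Y x) x) := by
      rw [reApplyInnerSelf_apply, sub_apply, one_apply_eq_self, inner_sub_left, _root_.map_sub,
        inner_self_eq_norm_mul_norm]
    rw [h2]
    linarith
  set s : ℝ := (Real.sqrt c)⁻¹ with hs
  refine ⟨(s : 𝕜) • (1 - Y), hpos.smul_of_nonneg ?_, ?_, fun Z hZ => ?_⟩
  · exact RCLike.ofReal_nonneg.2 (by positivity)
  · have hs2 : (s : 𝕜) * s * c = 1 := by
      have : s * s * c = 1 := by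
        rw [hs, ← mul_inv, Real.mul_self_sqrt hc0.le, inv_mul_cancel₀ hc0.ne']
      exact_mod_cast this
    rw [smul_mul_smul_comm, hYX, hXdef, sub_sub_cancel, smul_smul, hs2, one_smul]
  · have hZX : Commute Z X := (Commute.one_right Z).sub_right (hZ.smul_right _)
    have hZY : Commute Z Y := tendsto_nhds_unique (tendsto_const_nhds.mul hY)
      ((hY.mul tendsto_const_nhds).congr fun n => ((commute_sqrtIter 𝕜 hZX n).eq).symm)
    exact ((Commute.one_right Z).sub_right hZY).smul_right _

omit [CompleteSpace E] in
theorem IsPositive.apply_eq_zero_of_re_inner_eq_zero {C : E →L[𝕜] E} (hC : C.IsPositive) {x : E}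
    (h : RCLike.re (inner 𝕜 (C x) x) = 0) : C x = 0 := by
  -- The quadratic form of `C` is non-negative at `x + t C x` for each real `t`.
  have key : ∀ t : ℝ, 0 ≤ 2 * t * ‖C x‖ ^ 2 + t ^ 2 * RCLike.re (inner 𝕜 (C (C x)) (C x)) := by
    intro t
    have h1 := hC.re_inner_nonneg_left (x + (t : 𝕜) • C x)
    have h2 : inner 𝕜 (C (C x)) x = inner 𝕜 (C x) (C x) := hC.inner_left_eq_inner_right _ _
    simp only [_root_.map_add, map_smul, inner_add_left, inner_add_right, inner_smul_left,
      inner_smul_right, RCLike.conj_ofReal, RCLike.re_ofReal_mul, h2, h,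
      inner_self_eq_norm_sq] at h1
    linarith
  set b := RCLike.re (inner 𝕜 (C (C x)) (C x))
  have hb : 0 ≤ b := hC.re_inner_nonneg_left (C x)
  have h1 := key (-(‖C x‖ ^ 2 / (b + 1)))
  have h2 : 2 * -(‖C x‖ ^ 2 / (b + 1)) * ‖C x‖ ^ 2 + (-(‖C x‖ ^ 2 / (b + 1))) ^ 2 * b =
      -((‖C x‖ ^ 2 / (b + 1)) ^ 2 * (b + 2)) := by
    field_simp
    ring
  rw [h2] at h1
  have h3 : (‖C x‖ ^ 2 / (b + 1)) ^ 2 * (b + 2) = 0 :=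
    le_antisymm (by linarith) (by positivity)
  have h4 : b + 2 ≠ 0 := by positivity
  have h5 : b + 1 ≠ 0 := by positivity
  simpa [h4, h5] using h3

omit [CompleteSpace E] in
theorem IsPositive.eq_of_commute_of_mul_self_eq {C D : E →L[𝕜] E} (hC : C.IsPositive)
    (hD : D.IsPositive) (hCD : Commute C D) (h : C * C = D * D) : C = D := by
  ext x
  set y := C x - D x with hy
  have h1 : C y + D y = 0 := by
    have h2 : ((C + D) * (C - D)) x = 0 := by
      rw [← hCD.mul_self_sub_mul_self_eq, h, sub_self, zero_apply]
    exact h2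
  have h3 : RCLike.re (inner 𝕜 (C y) y) + RCLike.re (inner 𝕜 (D y) y) = 0 := by
    rw [← _root_.map_add, ← inner_add_left, h1, inner_zero_left, _root_.map_zero]
  have h4 := hC.re_inner_nonneg_left y
  have h5 := hD.re_inner_nonneg_left y
  have hCy : C y = 0 := hC.apply_eq_zero_of_re_inner_eq_zero (by linarith)
  have hDy : D y = 0 := hD.apply_eq_zero_of_re_inner_eq_zero (by linarith)
  have h6 : inner 𝕜 y y = 0 := by
    conv_lhs => rw [hy]
    rw [inner_sub_left, hC.inner_left_eq_inner_right, hD.inner_left_eq_inner_right, hCy, hDy,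
      inner_zero_right, sub_zero]
  exact sub_eq_zero.1 (inner_self_eq_zero.1 h6)

/-- The positive square root of a bounded operator is unique: all positive square roots of `D²`
agree with the one that commutes with every operator commuting with `D²`. -/
theorem IsPositive.eq_of_mul_self_eq {C D : E →L[𝕜] E} (hC : C.IsPositive) (hD : D.IsPositive)
    (h : C * C = D * D) : C = D := by
  obtain ⟨R, hR, hRD, hcomm⟩ := exists_isPositive_mul_self_eq D
  rw [hD.isSelfAdjoint.adjoint_eq] at hRD hcomm
  change R * R = D * D at hRD
  have h1 : Commute C R := hcomm C (by
    change Commute C (D * D)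
    rw [← h]
    exact (Commute.refl C).mul_right (Commute.refl C))
  have h2 : Commute D R := hcomm D ((Commute.refl D).mul_right (Commute.refl D))
  rw [hC.eq_of_commute_of_mul_self_eq hR h1 (h.trans hRD.symm),
    hD.eq_of_commute_of_mul_self_eq hR h2 hRD.symm]

/-! ### The polar decomposition of bounded operators -/

omit [CompleteSpace F] in
/-- If `‖C x‖ = ‖A x‖` for all `x`, then `C x ↦ A x` extends to a partial isometry from the
closure of `R(C)` onto the closure of `R(A)`. -/
theorem exists_partialIsometry {G : Type*} [NormedAddCommGroup G] [InnerProductSpace 𝕜 G]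
    [CompleteSpace G] (C : F →L[𝕜] G) (A : F →L[𝕜] E) (h : ∀ x, ‖C x‖ = ‖A x‖) :
    ∃ U : G →L[𝕜] E, U ∘L C = A ∧ LinearPMap.IsPartialIsometryOn U C.range.topologicalClosure
      A.range.topologicalClosure := by
  set M := C.range.topologicalClosure with hM
  have hMc : _root_.IsClosed (M : Set G) := C.range.isClosed_topologicalClosure
  have : CompleteSpace M := hMc.completeSpace_coe
  have hCM : ∀ x, C x ∈ M := fun x => Submodule.le_topologicalClosure _ ⟨x, rfl⟩
  let e : F →ₗ[𝕜] M := (C : F →ₗ[𝕜] G).codRestrict M hCM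
  have he : DenseRange e := by
    intro m
    rw [Topology.IsInducing.subtypeVal.closure_eq_preimage_closure_image, Set.mem_preimage,
      ← Set.range_comp]
    exact m.2
  have hle : ∀ x, ‖(A : F →ₗ[𝕜] E) x‖ ≤ 1 * ‖e x‖ := fun x => by
    rw [one_mul]
    exact (h x).ge
  let V : M →L[𝕜] E := (A : F →ₗ[𝕜] E).extendOfNorm e
  have hV : ∀ x, V (e x) = A x := LinearMap.extendOfNorm_eq he ⟨1, hle⟩
  have hVn : ∀ m, ‖V m‖ = ‖m‖ := by
    refine he.induction ?_ (isClosed_eq (by fun_prop) (by fun_prop))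
    rintro _ ⟨x, rfl⟩
    rw [hV]
    exact (h x).symm
  let U : G →L[𝕜] E := V ∘L M.orthogonalProjectionOnto
  have hU : ∀ m (hm : m ∈ M), U m = V ⟨m, hm⟩ := fun m hm =>
    congrArg V (M.orthogonalProjectionOnto_mem_subspace_eq_self ⟨m, hm⟩)
  refine ⟨U, ?_, ⟨fun m hm => ?_, fun m hm => ?_, ?_⟩⟩
  · ext x
    exact (hU _ (hCM x)).trans (hV x)
  · rw [hU m hm, hVn]
    rfl
  · exact (congrArg V (M.orthogonalProjectionOnto_eq_zero_iff.2 hm)).trans (map_zero V)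
  · have hrange : LinearMap.range (U : G →ₗ[𝕜] E) = LinearMap.range (V : M →ₗ[𝕜] E) := by
      ext y
      constructor
      · rintro ⟨x, rfl⟩
        exact ⟨_, rfl⟩
      · rintro ⟨⟨m, hm⟩, rfl⟩
        exact ⟨m, hU m hm⟩
    rw [hrange]
    refine le_antisymm ?_ (Submodule.topologicalClosure_minimal _ ?_ ?_)
    · rintro _ ⟨m, rfl⟩
      refine he.induction (P := fun m => V m ∈ A.range.topologicalClosure) ?_
        (A.range.isClosed_topologicalClosure.preimage V.continuous) m
      rintro _ ⟨x, rfl⟩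
      rw [hV]
      exact Submodule.le_topologicalClosure _ ⟨x, rfl⟩
    · rintro _ ⟨x, rfl⟩
      exact ⟨e x, hV x⟩
    · have hiso : Isometry V := AddMonoidHomClass.isometry_of_norm V hVn
      exact hiso.isClosedEmbedding.isClosed_range

end ContinuousLinearMap

namespace LinearPMap

variable {𝕜 E F : Type*} [RCLike 𝕜]
  [NormedAddCommGroup E] [InnerProductSpace 𝕜 E] [CompleteSpace E]
  [NormedAddCommGroup F] [InnerProductSpace 𝕜 F] [CompleteSpace F]

/-! ### The modulus of the Moore-Penrose inverse of a bounded operator -/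

theorem adjoint_prodOp_self_moorePenrose_ofBounded (B : F →L[𝕜] E) :
    (ofBounded B).moorePenrose.adjoint.prodOp (ofBounded B).moorePenrose =
      (ofBounded (B ∘L B.adjoint)).moorePenrose := by
  rw [adjoint_moorePenrose_ofBounded, prodOp_moorePenrose_ofBounded]

theorem ker_eq_ker_adjoint_of_mul_self_eq {B : F →L[𝕜] E} {C : E →L[𝕜] E} (hC : C.IsPositive)
    (h : C * C = B ∘L B.adjoint) : C.ker = B.adjoint.ker := by
  rw [← B.ker_self_comp_adjoint, ← h, ← C.ker_adjoint_comp_self, hC.isSelfAdjoint.adjoint_eq]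
  rfl

theorem isNonnegSqrt_moorePenrose_ofBounded {C : E →L[𝕜] E} (hC : C.IsPositive) :
    IsNonnegSqrt (ofBounded (C * C)).moorePenrose (ofBounded C).moorePenrose := by
  have hsa := hC.isSelfAdjoint.adjoint_eq
  have hadj : (ofBounded C).moorePenrose.adjoint = (ofBounded C).moorePenrose := by
    rw [adjoint_moorePenrose_ofBounded, hsa]
  refine ⟨hadj, fun x => ?_, ?_⟩
  · have hx := (mem_moorePenrose_ofBounded_graph C _ _).1 (mem_graph _ x)
    set y := (ofBounded C).moorePenrose x
    -- `x` differs from `C y` by an element of `N(C)`, to which `y` is orthogonal.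
    have h1 : inner 𝕜 y ((x : E) - C y) = 0 := by
      refine Submodule.inner_left_of_mem_orthogonal (K := C.ker) ?_ hx.1
      rw [hsa] at hx
      simp [hx.2]
    rw [inner_sub_right, sub_eq_zero] at h1
    rw [h1]
    exact hC.re_inner_nonneg_right y
  · have := adjoint_prodOp_self_moorePenrose_ofBounded C
    rw [hadj, hsa] at this
    exact this

/-- The range of a non-negative selfadjoint square root of `S = (B B*)^†` is closed: it is contained
in `N(S)ᗮ` and contains `R(S)`, and both are `N(B*)ᗮ`. -/
theorem IsNonnegSqrt.rangeSpace_eq {B : F →L[𝕜] E} {A : E →ₗ.[𝕜] E}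
    (hA : IsNonnegSqrt (ofBounded (B ∘L B.adjoint)).moorePenrose A) :
    A.rangeSpace = B.adjoint.kerᗮ := by
  have hBsa : (B ∘L B.adjoint).adjoint = B ∘L B.adjoint := by
    rw [ContinuousLinearMap.adjoint_comp, ContinuousLinearMap.adjoint_adjoint]
  have hform := adjoint_isFormalAdjoint hA.selfAdjoint.dense_domain
  rw [isSelfAdjoint_def.1 hA.selfAdjoint] at hform
  have hsymm : ∀ {a b c d}, (a, b) ∈ A.graph → (c, d) ∈ A.graph → inner 𝕜 b c = inner 𝕜 a d := by
    intro a b c d h1 h2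
    obtain ⟨x, rfl, rfl⟩ := (mem_graph_iff _).1 h1
    obtain ⟨y, rfl, rfl⟩ := (mem_graph_iff _).1 h2
    exact hform x y
  refine le_antisymm ?_ ?_
  · intro y hy
    obtain ⟨x, hxy⟩ := (mem_rangeSpace_iff_graph A y).1 hy
    intro n hn
    have h1 : (n, (0 : E)) ∈ (A.prodOp A).graph := by
      rw [hA.sq, ← mem_nullSpace_iff_graph, nullSpace_moorePenrose_ofBounded, hBsa,
        B.ker_self_comp_adjoint]
      exact hn
    obtain ⟨m, hm, hm0⟩ := (mem_prodOp_graph A A n 0).1 h1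
    have h2 : m = 0 := by
      rw [← inner_self_eq_zero (𝕜 := 𝕜), hsymm hm hm0, inner_zero_right]
    rw [h2] at hm
    rw [← hsymm hm hxy, inner_zero_left]
  · intro y hy
    rw [← B.ker_self_comp_adjoint, ← rangeSpace_moorePenrose_ofBounded, ← hA.sq,
      mem_rangeSpace_iff_graph] at hy
    obtain ⟨x, hx⟩ := hy
    obtain ⟨z, -, hz⟩ := (mem_prodOp_graph A A x y).1 hx
    exact (mem_rangeSpace_iff_graph A y).2 ⟨z, hz⟩

/-- Every non-negative selfadjoint square root of `(B B*)^†` is the Moore-Penrose inverse of a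
positive square root of `B B*`. -/
theorem IsNonnegSqrt.exists_isPositive {B : F →L[𝕜] E} {A : E →ₗ.[𝕜] E}
    (hA : IsNonnegSqrt (ofBounded (B ∘L B.adjoint)).moorePenrose A) :
    ∃ C : E →L[𝕜] E, C.IsPositive ∧ C * C = B ∘L B.adjoint ∧
      A = (ofBounded C).moorePenrose := by
  have hR : _root_.IsClosed (A.rangeSpace : Set E) := by
    rw [hA.rangeSpace_eq]
    exact Submodule.isClosed_orthogonal _
  obtain ⟨D, hD⟩ := exists_moorePenrose_eq_ofBounded hA.selfAdjoint.isClosed hR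
  have hAD := eq_moorePenrose_ofBounded hA.selfAdjoint.dense_domain hA.selfAdjoint.isClosed hR hD
  have hsa : D.adjoint = D := by
    refine moorePenrose_ofBounded_injective ?_
    change (ofBounded D.adjoint).moorePenrose = (ofBounded D).moorePenrose
    rw [← adjoint_moorePenrose_ofBounded, ← hAD]
    exact isSelfAdjoint_def.1 hA.selfAdjoint
  have hsq : D ∘L D.adjoint = B ∘L B.adjoint := by
    refine moorePenrose_ofBounded_injective ?_
    change (ofBounded _).moorePenrose = (ofBounded _).moorePenrose
    rw [← prodOp_moorePenrose_ofBounded, hsa, ← hAD, hA.sq]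
  refine ⟨D, ContinuousLinearMap.isPositive_def'.2
    ⟨ContinuousLinearMap.isSelfAdjoint_iff'.2 hsa, fun x => ?_⟩, by rwa [hsa] at hsq, hAD⟩
  obtain ⟨y, hy, hyx⟩ := exists_mem_ker_orthogonal D x
  have hgraph : (D y, y) ∈ A.graph := by
    rw [hAD, mem_moorePenrose_ofBounded_graph]
    exact ⟨hy, rfl⟩
  obtain ⟨z, hz, hzy⟩ := (mem_graph_iff _).1 hgraph
  have h1 := hA.nonneg z
  have h2 : A z = y := hzy
  have h3 : (z : E) = D y := hz
  have h4 : inner 𝕜 (D x) x = inner 𝕜 y (D y) := by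
    calc inner 𝕜 (D x) x = inner 𝕜 (D.adjoint y) x := by rw [hsa, hyx]
      _ = inner 𝕜 y (D y) := by rw [D.adjoint_inner_left, hyx]
  rw [ContinuousLinearMap.reApplyInnerSelf_apply, h4]
  rwa [h2, h3] at h1

/-- The modulus of `B^†` is the Moore-Penrose inverse of the positive square root of `B B*`. -/
theorem modulus_moorePenrose_ofBounded (B : F →L[𝕜] E) :
    IsNonnegSqrt ((ofBounded B).moorePenrose.adjoint.prodOp (ofBounded B).moorePenrose)
      (ofBounded B).moorePenrose.modulus ∧
    ∃ C : E →L[𝕜] E, C.IsPositive ∧ C * C = B ∘L B.adjoint ∧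
      (ofBounded B).moorePenrose.modulus = (ofBounded C).moorePenrose := by
  obtain ⟨C, hC, hCB, -⟩ := ContinuousLinearMap.exists_isPositive_mul_self_eq B
  have hex : ∃ A, IsNonnegSqrt
      ((ofBounded B).moorePenrose.adjoint.prodOp (ofBounded B).moorePenrose) A := by
    rw [adjoint_prodOp_self_moorePenrose_ofBounded, ← hCB]
    exact ⟨_, isNonnegSqrt_moorePenrose_ofBounded hC⟩
  have hspec : IsNonnegSqrt
      ((ofBounded B).moorePenrose.adjoint.prodOp (ofBounded B).moorePenrose)
      (ofBounded B).moorePenrose.modulus := by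
    rw [modulus, nonnegSqrt, dif_pos hex]
    exact hex.choose_spec
  refine ⟨hspec, ?_⟩
  rw [adjoint_prodOp_self_moorePenrose_ofBounded] at hspec
  exact hspec.exists_isPositive

/-! ### The polar decomposition of the Moore-Penrose inverse of a bounded operator -/

section Polar

variable {B : F →L[𝕜] E} {C : E →L[𝕜] E}

theorem closure_rangeSpace_moorePenrose_ofBounded (B : F →L[𝕜] E) :
    (ofBounded B).moorePenrose.rangeSpace.topologicalClosure = B.kerᗮ := by
  rw [rangeSpace_moorePenrose_ofBounded]
  exact (Submodule.isClosed_orthogonal _).submodule_topologicalClosure_eq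

theorem norm_apply_eq_of_mul_self_eq (hC : C.IsPositive) (hCB : C * C = B ∘L B.adjoint) (x : E) :
    ‖C x‖ = ‖B.adjoint x‖ := by
  have h1 : inner 𝕜 (C x) (C x) = inner 𝕜 (B.adjoint x) (B.adjoint x) := by
    rw [hC.inner_left_eq_inner_right, B.adjoint_inner_left]
    exact congrArg (fun D : E →L[𝕜] E => inner 𝕜 x (D x)) hCB
  rw [inner_self_eq_norm_sq_to_K, inner_self_eq_norm_sq_to_K] at h1
  exact (sq_eq_sq₀ (norm_nonneg _) (norm_nonneg _)).1 (by exact_mod_cast h1)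

theorem IsPolarIsometry.range_eq {U : E →L[𝕜] F}
    (hU : IsPolarIsometry (ofBounded B).moorePenrose U) : U.range = B.kerᗮ := by
  rw [← closure_rangeSpace_moorePenrose_ofBounded]
  exact hU.partialIsometry.range_eq

omit [CompleteSpace F] in
theorem IsPolarIsometry.apply_eq_zero {U : E →L[𝕜] F}
    (hU : IsPolarIsometry (ofBounded B).moorePenrose U)
    (hmod : (ofBounded B).moorePenrose.modulus = (ofBounded C).moorePenrose) {x : E}
    (hx : C x = 0) : U x = 0 := by
  refine hU.partialIsometry.vanish x ?_
  rw [hmod, closure_rangeSpace_moorePenrose_ofBounded]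
  exact Submodule.le_orthogonal_orthogonal _ hx

/-- If `B^† = U C^†` is the polar decomposition, then `B U = C`. -/
theorem IsPolarIsometry.comp_eq (hC : C.IsPositive) (hCB : C * C = B ∘L B.adjoint)
    (hmod : (ofBounded B).moorePenrose.modulus = (ofBounded C).moorePenrose) {U : E →L[𝕜] F}
    (hU : IsPolarIsometry (ofBounded B).moorePenrose U) : B ∘L U = C := by
  have hker := ker_eq_ker_adjoint_of_mul_self_eq hC hCB
  have hperp : ∀ z ∈ C.kerᗮ, B (U z) = C z := by
    intro z hz
    have h1 : (C z, z) ∈ (ofBounded B).moorePenrose.modulus.graph := by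
      rw [hmod, mem_moorePenrose_ofBounded_graph]
      exact ⟨hz, rfl⟩
    have h2 : (C z, U z) ∈ (ofBounded B).moorePenrose.graph := by
      rw [hU.factor, mem_compPMap_graph]
      exact ⟨z, h1, rfl⟩
    rw [mem_moorePenrose_ofBounded_graph] at h2
    refine eq_of_mem_ker_orthogonal (B := B.adjoint) ?_ ?_ h2.2
    · simpa using adjoint_apply_mem_ker_orthogonal B.adjoint (U z)
    · have h3 := adjoint_apply_mem_ker_orthogonal C z
      rwa [hC.isSelfAdjoint.adjoint_eq, hker] at h3
  ext x
  obtain ⟨k, hk, z, hz, rfl⟩ := C.ker.exists_add_mem_mem_orthogonal x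
  have hk' : C k = 0 := hk
  rw [ContinuousLinearMap.comp_apply, _root_.map_add, _root_.map_add, _root_.map_add,
    hperp z hz, hU.apply_eq_zero hmod hk', hk', _root_.map_zero]

/-- If `B^† = U C^†` is the polar decomposition, then `B* = U C`. -/
theorem IsPolarIsometry.comp_eq_adjoint (hC : C.IsPositive) (hCB : C * C = B ∘L B.adjoint)
    (hmod : (ofBounded B).moorePenrose.modulus = (ofBounded C).moorePenrose) {U : E →L[𝕜] F}
    (hU : IsPolarIsometry (ofBounded B).moorePenrose U) : U ∘L C = B.adjoint := by
  ext x
  -- Both sides lie in `N(B)ᗮ` and `B U C x = C² x = B B* x`.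
  refine eq_of_mem_ker_orthogonal (B := B) ?_ (adjoint_apply_mem_ker_orthogonal B x) ?_
  · rw [← hU.range_eq]
    exact ⟨C x, rfl⟩
  · have h1 := congrArg (fun D : E →L[𝕜] E => D (C x)) (hU.comp_eq hC hCB hmod)
    exact h1.trans (congrArg (fun D : E →L[𝕜] E => D x) hCB)

theorem exists_isPolarIsometry_moorePenrose_ofBounded (B : F →L[𝕜] E) :
    ∃ U, IsPolarIsometry (ofBounded B).moorePenrose U := by
  obtain ⟨-, C, hC, hCB, hmod⟩ := modulus_moorePenrose_ofBounded B
  have hsa := hC.isSelfAdjoint.adjoint_eq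
  have hker := ker_eq_ker_adjoint_of_mul_self_eq hC hCB
  obtain ⟨U, hUC, hU⟩ := ContinuousLinearMap.exists_partialIsometry C B.adjoint
    (norm_apply_eq_of_mul_self_eq hC hCB)
  have hCr : C.range.topologicalClosure = C.kerᗮ := by rw [C.orthogonal_ker, hsa]
  rw [hCr, ← B.orthogonal_ker] at hU
  have hvan : ∀ k, C k = 0 → U k = 0 := fun k hk =>
    hU.vanish k (Submodule.le_orthogonal_orthogonal _ hk)
  have hBU : ∀ x, B (U x) = C x := by
    -- The two sides agree on `R(C)`, hence on its closure `N(C)ᗮ`, and they vanish on `N(C)`.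
    have hclosed : _root_.IsClosed {x | B (U x) = C x} := isClosed_eq (by fun_prop) (by fun_prop)
    have hle : C.range ≤ LinearMap.eqLocus (B ∘L U : E →L[𝕜] E).toLinearMap C.toLinearMap := by
      rintro _ ⟨x, rfl⟩
      have h1 : U (C x) = B.adjoint x := congrArg (fun D : E →L[𝕜] F => D x) hUC
      have h2 : C (C x) = B (B.adjoint x) := congrArg (fun D : E →L[𝕜] E => D x) hCB
      exact (congrArg B h1).trans h2.symm
    have hle' := Submodule.topologicalClosure_minimal _ hle hclosed
    rw [hCr] at hle'
    intro x
    obtain ⟨k, hk, z, hz, rfl⟩ := C.ker.exists_add_mem_mem_orthogonal x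
    have hk' : C k = 0 := hk
    have hz' : B (U z) = C z := hle' hz
    rw [_root_.map_add, _root_.map_add, _root_.map_add, hvan k hk', hk', hz', _root_.map_zero]
  have hCB' : ∀ x y, C.adjoint (C y) = C.adjoint x ↔ B.adjoint (B (U y)) = B.adjoint x := by
    intro x y
    rw [hBU, ← sub_eq_zero, ← _root_.map_sub, ← sub_eq_zero (a := B.adjoint _), ← _root_.map_sub,
      hsa]
    exact SetLike.ext_iff.1 hker _
  refine ⟨U, ?_, ext_graph fun x y => ?_⟩
  · rw [hmod, closure_rangeSpace_moorePenrose_ofBounded, closure_rangeSpace_moorePenrose_ofBounded]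
    exact hU
  · simp only [mem_compPMap_graph, hmod, mem_moorePenrose_ofBounded_graph, hCB']
    rw [← hU.range_eq]
    constructor
    · rintro ⟨⟨z, rfl⟩, h⟩
      obtain ⟨k, hk, z, hz, rfl⟩ := C.ker.exists_add_mem_mem_orthogonal z
      have hk' : U (k + z) = U z := by rw [_root_.map_add, hvan k hk, zero_add]
      exact ⟨z, ⟨hz, hk' ▸ h⟩, hk'⟩
    · rintro ⟨z, ⟨-, h⟩, rfl⟩
      exact ⟨⟨z, rfl⟩, h⟩

theorem isPolarIsometry_polarIsometry_moorePenrose_ofBounded (B : F →L[𝕜] E) :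
    IsPolarIsometry (ofBounded B).moorePenrose (ofBounded B).moorePenrose.polarIsometry := by
  have hex := exists_isPolarIsometry_moorePenrose_ofBounded B
  rw [polarIsometry, dif_pos hex]
  exact hex.choose_spec

/-- With `B^† = U C^†` and `(B*)^† = V D^†` the polar decompositions, `V = U*`. -/
theorem IsPolarIsometry.adjoint_eq {D : F →L[𝕜] F} (hC : C.IsPositive)
    (hCB : C * C = B ∘L B.adjoint)
    (hmodC : (ofBounded B).moorePenrose.modulus = (ofBounded C).moorePenrose)
    (hD : D.IsPositive) (hDB : D * D = B.adjoint ∘L B.adjoint.adjoint)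
    (hmodD : (ofBounded B.adjoint).moorePenrose.modulus = (ofBounded D).moorePenrose)
    {U : E →L[𝕜] F} {V : F →L[𝕜] E} (hU : IsPolarIsometry (ofBounded B).moorePenrose U)
    (hV : IsPolarIsometry (ofBounded B.adjoint).moorePenrose V) : V = U.adjoint := by
  have hBU := hU.comp_eq hC hCB hmodC
  have hUC := hU.comp_eq_adjoint hC hCB hmodC
  have hBV := hV.comp_eq hD hDB hmodD
  have hB : B = C ∘L U.adjoint := by
    rw [← B.adjoint_adjoint, ← hUC, ContinuousLinearMap.adjoint_comp, hC.isSelfAdjoint.adjoint_eq]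
  -- `U B = U C U*` is a positive square root of `B* B`, so that it is `D`.
  have hUB : U ∘L B = D := by
    refine ContinuousLinearMap.IsPositive.eq_of_mul_self_eq ?_ hD ?_
    · rw [hB]
      exact hC.conj_adjoint U
    · rw [hDB, B.adjoint_adjoint, ← hUC]
      change U ∘L B ∘L U ∘L B = (U ∘L C) ∘L B
      rw [← ContinuousLinearMap.comp_assoc B U B, hBU, ContinuousLinearMap.comp_assoc]
  have hBU' : B.adjoint ∘L U.adjoint = D := by
    rw [← ContinuousLinearMap.adjoint_comp, hUB, hD.isSelfAdjoint.adjoint_eq]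
  ext y
  refine eq_of_mem_ker_orthogonal (B := B.adjoint) ?_ ?_ ?_
  · rw [← hV.range_eq]
    exact ⟨y, rfl⟩
  · refine Submodule.orthogonal_le ?_ (adjoint_apply_mem_ker_orthogonal U y)
    rw [← ker_eq_ker_adjoint_of_mul_self_eq hC hCB]
    exact fun k hk => hU.apply_eq_zero hmodC hk
  · exact congrArg (fun A : F →L[𝕜] F => A y) (hBV.trans hBU'.symm)

end Polar

/-! ### The generalized Cauchy dual -/

theorem cauchyDual_moorePenrose_ofBounded (B : F →L[𝕜] E) :
    (ofBounded B).moorePenrose.cauchyDual = ofBounded B.adjoint := by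
  rw [cauchyDual, adjoint_prodOp_self_moorePenrose_ofBounded, moorePenrose_moorePenrose_ofBounded]
  refine ext_graph fun x z => ?_
  simp only [mem_prodOp_graph, mem_ofBounded_graph, exists_eq_left,
    mem_moorePenrose_ofBounded_graph]
  constructor
  · rintro ⟨hz, h⟩
    -- `B* B z = B* B B* x` with `z` and `B* x` both orthogonal to `N(B) = N(B* B)`.
    rw [← B.ker_adjoint_comp_self] at hz
    refine eq_of_mem_ker_orthogonal hz ?_ h
    rw [B.ker_adjoint_comp_self]
    exact adjoint_apply_mem_ker_orthogonal B x
  · rintro rfl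
    exact ⟨adjoint_apply_mem_ker_orthogonal B x, rfl⟩

end LinearPMap
end

theorem theorem2p6 {𝕜 H K : Type*} [RCLike 𝕜]
    [NormedAddCommGroup H] [InnerProductSpace 𝕜 H] [CompleteSpace H]
    [NormedAddCommGroup K] [InnerProductSpace 𝕜 K] [CompleteSpace K]
    (T : H →ₗ.[𝕜] K) (hdense : Dense (T.domain : Set H)) (hclosed : T.IsClosed)
    (hrange : IsClosed (T.rangeSpace : Set K)) :
    -- the polar decomposition `T = U_T |T|`
    (LinearPMap.IsNonnegSqrt (T.adjoint.prodOp T) T.modulus ∧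
      T.IsPolarIsometry T.polarIsometry) ∧
    -- `w(T) = U_T |T|^†`
    T.cauchyDual = (LinearPMap.ofBounded T.polarIsometry).prodOp T.modulus.moorePenrose ∧
    -- `T^†` and `|T|^†` are bounded operators on the whole space, of the same norm
    (∃ (S : K →L[𝕜] H) (R : H →L[𝕜] H),
      T.moorePenrose = LinearPMap.ofBounded S ∧
      T.modulus.moorePenrose = LinearPMap.ofBounded R ∧ ‖S‖ = ‖R‖) ∧
    -- `T^† = |T|^† U_{T*}` and `(T*)^† = U_T |T|^†`
    T.moorePenrose =
      T.modulus.moorePenrose.prodOp (LinearPMap.ofBounded T.adjoint.polarIsometry) ∧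
    T.adjoint.moorePenrose =
      (LinearPMap.ofBounded T.polarIsometry).prodOp T.modulus.moorePenrose := by
  open LinearPMap in
  obtain ⟨B, hB⟩ := exists_moorePenrose_eq_ofBounded hclosed hrange
  obtain rfl := eq_moorePenrose_ofBounded hdense hclosed hrange hB
  obtain ⟨hsqrt, C, hC, hCB, hmodC⟩ := modulus_moorePenrose_ofBounded B
  obtain ⟨-, D, hD, hDB, hmodD⟩ := modulus_moorePenrose_ofBounded B.adjoint
  have hU := isPolarIsometry_polarIsometry_moorePenrose_ofBounded B
  have hV := isPolarIsometry_polarIsometry_moorePenrose_ofBounded B.adjoint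
  have hUC := hU.comp_eq_adjoint hC hCB hmodC
  have hVU := hU.adjoint_eq hC hCB hmodC hD hDB hmodD hV
  have hmp : (ofBounded B).moorePenrose.modulus.moorePenrose = ofBounded C := by
    rw [hmodC, moorePenrose_moorePenrose_ofBounded]
  have hUC' : (ofBounded (ofBounded B).moorePenrose.polarIsometry).prodOp
      (ofBounded B).moorePenrose.modulus.moorePenrose = ofBounded B.adjoint := by
    rw [hmp, prodOp_ofBounded, hUC]
  refine ⟨⟨hsqrt, hU⟩, ?_, ⟨B, C, hB, hmp, ?_⟩, ?_, ?_⟩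
  · rw [hUC', cauchyDual_moorePenrose_ofBounded]
  · have h1 : ‖C‖ = ‖B.adjoint‖ :=
      ContinuousLinearMap.opNorm_ext _ _ (norm_apply_eq_of_mul_self_eq hC hCB)
    rw [h1, LinearIsometryEquiv.norm_map]
  · have hBC : B = C ∘L (ofBounded B).moorePenrose.polarIsometry.adjoint := by
      have h := congrArg ContinuousLinearMap.adjoint hUC
      rw [ContinuousLinearMap.adjoint_comp, B.adjoint_adjoint, hC.isSelfAdjoint.adjoint_eq] at h
      exact h.symm
    rw [hmp, adjoint_moorePenrose_ofBounded, hVU, prodOp_ofBounded, hB]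
    exact congrArg ofBounded hBC
  · rw [hUC', adjoint_moorePenrose_ofBounded, moorePenrose_moorePenrose_ofBounded]
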